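/- Let $M$ be a smooth $3$-manifold (Hausdorff, second countable, without boundary) and let $\alpha\in\Omega^1(M)$ be a smooth $1$-form. For a Riemannian metric $g$ and an orientation of $M$, let $\ast$ be the Hodge star operator. The form $\alpha$ is a *contact form* if $\alpha\wedge d\alpha$ is nowhere zero; it then induces an orientation of $M$, the one for which $\alpha\wedge d\alpha$ is positive. The form $\alpha$ is a *rotational Beltrami $1$-form* (for $g$ and the orientation) if $d\alpha=f\ast\alpha$ for some nowhere zero $f\in C^\infty(M)$. A metric $g$ is *adapted* to a contact form $\alpha$ if $d\alpha=2\ast\alpha$ and $g(\alpha^\sharp,\alpha^\sharp)=1$, where $\alpha^\sharp$ is the vector field dual to $\alpha$ and $\ast$ is taken with respect to $g$ and the orientation induced by $\alpha$. (i) If, for some orientation and some Riemannian metric on $M$, $\alpha$ is a rotational Beltrami $1$-form that is nowhere zero, then $\alpha$ is a contact form. (ii) Let $\alpha$ be a contact form and let $M$ carry the orientation induced by $\alpha$. Then $\alpha$ has an adapted Riemannian metric. Moreover, for every strictly positive $f\in C^\infty(M)$ and every metric $g$ adapted to $\alpha$, the Riemannian metric $\widetilde g=\frac{4}{f^2}\,g$,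 with Hodge star operator $\widetilde\ast$, satisfies $$d\alpha=f\,\widetilde\ast\,\alpha ,$$ so that $\alpha$ is a rotational Beltrami $1$-form for $\widetilde g$. If $M$ is non-empty, the Riemannian metrics that satisfy this equation, for given $\alpha$ and $f$, are not unique: there are at least two. -/

import Mathlib

open scoped Manifold ContDiff Topology
open Bundle

noncomputable section

namespace BeltramiContact

/-- The model space `ℝ³`. -/
abbrev E3 : Type := EuclideanSpace ℝ (Fin 3)

/-! ### Linear algebra in a three-dimensional real vector space -/

section Linear

variable {V : Type*} [AddCommGroup V] [Module ℝ V]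

/-- The wedge product `a ∧ β` of a linear form and an alternating bilinear form:
`(a ∧ β)(u, v, w) = a(u) β(v, w) - a(v) β(u, w) + a(w) β(u, v)`. -/
def wedge (a : V →ₗ[ℝ] ℝ) (β : V [⋀^Fin 2]→ₗ[ℝ] ℝ) : V [⋀^Fin 3]→ₗ[ℝ] ℝ :=
  AlternatingMap.alternatizeUncurryFin (a.smulRight β)

/-- The matrix `(g_{ij}) = (g(b_i, b_j))` of a bilinear form `g` in a basis `b`. -/
def gram (b : Module.Basis (Fin 3) ℝ V) (g : V → V → ℝ) : Matrix (Fin 3) (Fin 3) ℝ :=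
  Matrix.of fun i j => g (b i) (b j)

/-- The vector `a^♯ = ∑ g^{ij} a_i b_j`, where `(g^{ij})` is the inverse of `(g_{ij})` and
`a_i = a(b_i)`. -/
def sharpIn (b : Module.Basis (Fin 3) ℝ V) (g : V → V → ℝ) (a : V →ₗ[ℝ] ℝ) : V :=
  ∑ i, ∑ j, (a (b i) * (gram b g)⁻¹ i j) • b j

/-- The Hodge star `* : Λ¹ → Λ²` in a positively oriented basis `b`, with dual basis `b^i`:
`* a = √|g| ∑_{i,l} a_i g^{il} · (1/2) ∑_{j,k} ε_{ljk} b^j ∧ b^k`, where the form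
`(1/2) ∑_{j,k} ε_{ljk} b^j ∧ b^k` is `(v, w) ↦ det_b (b_l, v, w)`. -/
def hodgeIn (b : Module.Basis (Fin 3) ℝ V) (g : V → V → ℝ) (a : V →ₗ[ℝ] ℝ) :
    V [⋀^Fin 2]→ₗ[ℝ] ℝ :=
  Real.sqrt (gram b g).det •
    ∑ i, ∑ l, (a (b i) * (gram b g)⁻¹ i l) • b.det.curryLeft (b l)

end Linear

/-! ### Forms, metrics and orientations on a smooth 3-manifold without boundary -/

section Manifold

variable (M : Type*) [TopologicalSpace M] [ChartedSpace E3 M] [IsManifold (𝓡 3) ∞ M]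

/-- Smooth 1-forms: smooth sections of the cotangent bundle. -/
abbrev OneForm : Type _ :=
  ContMDiffSection (𝓡 3) (E3 →L[ℝ] ℝ) ∞ (fun x : M => TangentSpace (𝓡 3) x →L[ℝ] ℝ)

/-- Smooth Riemannian metrics. -/
abbrev Metric3 : Type _ :=
  ContMDiffRiemannianMetric (𝓡 3) ∞ E3 (fun x : M => TangentSpace (𝓡 3) x)

/-- The derivative at `x` of the chart at `x₀`. -/
def chartDeriv {M : Type*} [TopologicalSpace M] [ChartedSpace E3 M] (x₀ x : M) :
    TangentSpace (𝓡 3) x →L[ℝ] E3 :=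
  mfderiv (𝓡 3) 𝓘(ℝ, E3) (extChartAt (𝓡 3) x₀) x

/-- The derivative at `u` of the inverse of the chart at `x₀`. -/
def chartSymmDeriv {M : Type*} [TopologicalSpace M] [ChartedSpace E3 M] (x₀ : M) (u : E3) :
    E3 →L[ℝ] TangentSpace (𝓡 3) ((extChartAt (𝓡 3) x₀).symm u) :=
  mfderiv 𝓘(ℝ, E3) (𝓡 3) (extChartAt (𝓡 3) x₀).symm u

/-- An orientation of a 3-manifold: an orientation of every tangent space which, near every
point `x₀`, is given by one fixed constant-coefficient volume form in the chart at `x₀`. -/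
structure ManifoldOrientation where
  /-- the orientation of the tangent space at `x` -/
  at' (x : M) : Orientation ℝ (TangentSpace (𝓡 3) x) (Fin 3)
  coherent (x₀ : M) : ∃ η : E3 [⋀^Fin 3]→ₗ[ℝ] ℝ, ∀ᶠ x in 𝓝 x₀,
    ∃ h : η.compLinearMap (chartDeriv x₀ x).toLinearMap ≠ 0,
      at' x = rayOfNeZero ℝ _ h

variable {M}

/-- The basis of coordinate vectors at `x` in the preferred chart at `x`. -/
def coordBasis (x : M) : Module.Basis (Fin 3) ℝ (TangentSpace (𝓡 3) x) :=
  (EuclideanSpace.basisFun (Fin 3) ℝ).toBasis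

/-- The coordinate expression, on the target of the chart at `x₀`, of a 1-form: its pullback
under the inverse of the chart. -/
def localForm (α : OneForm M) (x₀ : M) (u : E3) : E3 →L[ℝ] ℝ :=
  (α ((extChartAt (𝓡 3) x₀).symm u)).comp (chartSymmDeriv x₀ u)

/-- The exterior derivative `dα` at `x`: the exterior derivative of the coordinate expression
of `α` in the chart at `x`, pulled back by the chart. -/
def dForm (α : OneForm M) (x : M) : TangentSpace (𝓡 3) x [⋀^Fin 2]→ₗ[ℝ] ℝ :=
  (extDeriv (fun u => ContinuousAlternatingMap.ofSubsingleton ℝ E3 ℝ (0 : Fin 1)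
      (localForm α x u)) (extChartAt (𝓡 3) x x)).toAlternatingMap.compLinearMap
    (chartDeriv x x).toLinearMap

/-- The 3-form `α ∧ dα`. -/
def wedgeD (α : OneForm M) (x : M) : TangentSpace (𝓡 3) x [⋀^Fin 3]→ₗ[ℝ] ℝ :=
  wedge (α x).toLinearMap (dForm α x)

/-- A contact form: `α ∧ dα` is nowhere zero. -/
def IsContactForm (α : OneForm M) : Prop := ∀ x, wedgeD α x ≠ 0

/-- `o` is the orientation induced by the contact form `α`, that is, the one for which `α ∧ dα`
is a positive volume form. -/
def IsInducedOrientation (o : ManifoldOrientation M) (α : OneForm M) : Prop :=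
  ∀ x, ∃ h : wedgeD α x ≠ 0, o.at' x = rayOfNeZero ℝ _ h

/-- The vector field `α^♯` metrically dual to `α`. -/
def sharp (g : Metric3 M) (α : OneForm M) (x : M) : TangentSpace (𝓡 3) x :=
  sharpIn (coordBasis x) (fun v w => g.inner x v w) (α x).toLinearMap

/-- The Hodge star `*α` of a 1-form, for the metric `g` and the orientation `o`; it is computed
in the coordinate basis, with one vector negated if that basis is negatively oriented. -/
def hodge (o : ManifoldOrientation M) (g : Metric3 M) (α : OneForm M) (x : M) :
    TangentSpace (𝓡 3) x [⋀^Fin 2]→ₗ[ℝ] ℝ :=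
  hodgeIn ((coordBasis x).adjustToOrientation (o.at' x)) (fun v w => g.inner x v w)
    (α x).toLinearMap

/-- The equation `dα = f * α`. -/
def BeltramiEq (o : ManifoldOrientation M) (g : Metric3 M) (f : C^∞⟮𝓡 3, M; ℝ⟯)
    (α : OneForm M) : Prop :=
  ∀ x, dForm α x = f x • hodge o g α x

/-- `α` is a rotational Beltrami 1-form: `dα = f * α` for some nowhere zero smooth function
`f`. -/
def IsRotationalBeltrami (o : ManifoldOrientation M) (g : Metric3 M) (α : OneForm M) : Prop :=
  ∃ f : C^∞⟮𝓡 3, M; ℝ⟯, (∀ x, f x ≠ 0) ∧ BeltramiEq o g f α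

/-- The contact form `α` and the metric `g` are adapted: `dα = 2 * α` and `g(α^♯, α^♯) = 1`. -/
def IsAdapted (o : ManifoldOrientation M) (g : Metric3 M) (α : OneForm M) : Prop :=
  IsContactForm α ∧ ∀ x, dForm α x = (2 : ℝ) • hodge o g α x ∧
    g.inner x (sharp g α x) (sharp g α x) = 1

/-- `g' = μ g` for the function `μ`. -/
def IsRescaling (μ : M → ℝ) (g g' : Metric3 M) : Prop :=
  ∀ (x : M) (v w : TangentSpace (𝓡 3) x), g'.inner x v w = μ x * g.inner x v w

end Manifold

end BeltramiContact

end

open BeltramiContact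

/-!
Everything rests on `*α = ι_{α♯} vol`. If `R` is a vector with `a(R) = 1` and `B` is an inner
product with `B(R, ·) = p a`, this turns `β = c * a` into the two conditions `ι_R β = 0` and
`p a ∧ β = c vol`. It also gives `a ∧ *a = a(a♯) vol`, so a rotational Beltrami form without zeros
is a contact form.

Conversely, the inner products for which the Reeb vector of a contact form `α` is dual to `α` form
a convex set at every point, and `α ⊗ α + ∑ᵢ ι_{eᵢ}dα ⊗ ι_{eᵢ}dα` is one of them for any frame `e`;
a partition of unity yields a metric `g` of this kind. The metric `s² α ⊗ α + q (g - α ⊗ α)` has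
volume form `s q vol`. Hence `s = 1`, with `q` half the ratio of `α ∧ dα` to `vol`, gives an
adapted metric, and over an adapted metric the functions `s = c / f` and `q = 2 c / f²` give, for
every constant `c > 0`, a solution of `dα = f * α`; the rescaling `4 g / f²` is the case `c = 2`.
-/

noncomputable section

namespace BeltramiContact

section AlternatingForms

variable {V : Type*} [AddCommGroup V] [Module ℝ V] {a : V →ₗ[ℝ] ℝ} {β : V [⋀^Fin 2]→ₗ[ℝ] ℝ}

theorem wedge_apply (a : V →ₗ[ℝ] ℝ) (β : V [⋀^Fin 2]→ₗ[ℝ] ℝ) (u v w : V) :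
    wedge a β ![u, v, w] = a u * β ![v, w] - a v * β ![u, w] + a w * β ![u, v] := by
  have h₁ : (1 : Fin 3).removeNth ![u, v, w] = ![u, w] := List.ofFn_injective rfl
  have h₂ : (2 : Fin 3).removeNth ![u, v, w] = ![u, v] := List.ofFn_injective rfl
  simp [wedge, AlternatingMap.alternatizeUncurryFin_apply, Fin.sum_univ_three, h₁, h₂,
    ← sub_eq_add_neg]

theorem wedge_smul (a : V →ₗ[ℝ] ℝ) (c : ℝ) (β : V [⋀^Fin 2]→ₗ[ℝ] ℝ) :
    wedge a (c • β) = c • wedge a β := by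
  rw [wedge, wedge, ← AlternatingMap.alternatizeUncurryFin_smul]
  congr 1
  ext v
  simp [mul_left_comm]

theorem map_pair_self (β : V [⋀^Fin 2]→ₗ[ℝ] ℝ) (v : V) : β ![v, v] = 0 :=
  β.map_eq_zero_of_eq ![v, v] (i := 0) (j := 1) rfl zero_ne_one

theorem map_pair_swap (β : V [⋀^Fin 2]→ₗ[ℝ] ℝ) (v w : V) : β ![v, w] = -β ![w, v] := by
  have hswap : ![v, w] = ![w, v] ∘ Equiv.swap 0 1 := List.ofFn_injective rfl
  rw [hswap, β.map_swap ![w, v] zero_ne_one]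

theorem curryLeft_wedge {v : V} (hv : β.curryLeft v = 0) :
    (wedge a β).curryLeft v = a v • β := by
  have hβ (w : V) : β ![v, w] = 0 := DFunLike.congr_fun hv ![w]
  ext w
  have hw : w = ![w 0, w 1] := List.ofFn_injective rfl
  rw [hw, AlternatingMap.curryLeft_apply_apply, wedge_apply, hβ, hβ]
  simp

/-- The Reeb vector of the pair `(a, β)`: normalised by `a(R) = 1` and spanning the kernel of
`β`. For `a = α x` and `β = dα x` these are the values of the Reeb vector field of `α`. -/
structure IsReebVector (a : V →ₗ[ℝ] ℝ) (β : V [⋀^Fin 2]→ₗ[ℝ] ℝ) (R : V) : Prop where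
  apply_eq_one : a R = 1
  curryLeft_eq_zero : β.curryLeft R = 0

variable (b : Module.Basis (Fin 3) ℝ V)

include b

/- The 4-form `a ∧ η` vanishes in dimension three; contract it with `v`. -/
theorem wedge_curryLeft (a : V →ₗ[ℝ] ℝ) (η : V [⋀^Fin 3]→ₗ[ℝ] ℝ) (v : V) :
    wedge a (η.curryLeft v) = a v • η := by
  have h : AlternatingMap.alternatizeUncurryFin (a.smulRight η) = 0 :=
    b.ext_alternating fun f hf => absurd (Fintype.card_le_of_injective f hf) (by simp)
  ext w
  have hw := DFunLike.congr_fun h (Matrix.vecCons v w)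
  rw [AlternatingMap.alternatizeUncurryFin_apply, Fin.sum_univ_succ] at hw
  have hsucc (i : Fin 3) : i.succ.removeNth (Matrix.vecCons v w) =
      Matrix.vecCons v (i.removeNth w) := Fin.cons_comp_succ_succAbove v w i
  simp only [hsucc, wedge, AlternatingMap.alternatizeUncurryFin_apply, pow_succ,
    LinearMap.smulRight_apply, AlternatingMap.smul_apply, AlternatingMap.curryLeft_apply_apply,
    mul_neg_one, neg_smul, Finset.sum_neg_distrib, Fin.val_zero, pow_zero, one_smul, Fin.val_succ,
    Matrix.cons_val_zero, Matrix.cons_val_succ, Fin.removeNth_zero, Fin.tail_def] at hw ⊢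
  exact (add_neg_eq_zero.1 hw).symm

theorem eq_zero_of_curryLeft_eq_zero {η : V [⋀^Fin 3]→ₗ[ℝ] ℝ} (hη : η ≠ 0) {v : V}
    (hv : η.curryLeft v = 0) : v = 0 := by
  refine b.forall_coord_eq_zero_iff.1 fun i => ?_
  have h : b.coord i v • η = 0 := by
    rw [← wedge_curryLeft b, hv, ← zero_smul ℝ (0 : V [⋀^Fin 2]→ₗ[ℝ] ℝ), wedge_smul, zero_smul]
  exact (smul_eq_zero.1 h).resolve_right hη

theorem eq_div_smul {θ : V [⋀^Fin 3]→ₗ[ℝ] ℝ} (hθ : θ b ≠ 0) (η : V [⋀^Fin 3]→ₗ[ℝ] ℝ) :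
    η = (η b / θ b) • θ := by
  rw [AlternatingMap.eq_smul_basis_det b θ, smul_smul, AlternatingMap.smul_apply, b.det_self]
  simp only [smul_eq_mul, mul_one, div_mul_cancel₀ _ hθ]
  exact AlternatingMap.eq_smul_basis_det b η

theorem sameRay_of_apply_mul_apply_pos {η θ : V [⋀^Fin 3]→ₗ[ℝ] ℝ} (h : 0 < η b * θ b) :
    SameRay ℝ η θ := by
  rw [eq_div_smul b (right_ne_zero_of_mul h.ne') η]
  refine SameRay.sameRay_pos_smul_left _ ?_
  rcases mul_pos_iff.1 h with ⟨hη, hθ⟩ | ⟨hη, hθ⟩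
  exacts [div_pos hη hθ, div_pos_of_neg_of_neg hη hθ]

theorem apply_pos_of_orientation_eq {η : V [⋀^Fin 3]→ₗ[ℝ] ℝ} (hη : η ≠ 0)
    (h : b.orientation = rayOfNeZero ℝ η hη) : 0 < η b := by
  have hb : η b ≠ 0 := (AlternatingMap.map_basis_ne_zero_iff b η).2 hη
  rw [Module.Basis.orientation, ray_eq_iff, AlternatingMap.eq_smul_basis_det b η] at h
  exact (sameRay_smul_right_iff_of_ne b.det_ne_zero hb).1 h

theorem exists_curryLeft_det_eq (β : V [⋀^Fin 2]→ₗ[ℝ] ℝ) : ∃ v : V, b.det.curryLeft v = β := by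
  refine ⟨β ![b 1, b 2] • b 0 - β ![b 0, b 2] • b 1 + β ![b 0, b 1] • b 2,
    b.ext_alternating fun f _ => ?_⟩
  have hpair : (fun i => b (f i)) = ![b (f 0), b (f 1)] := List.ofFn_injective rfl
  rw [hpair, AlternatingMap.curryLeft_apply_apply, b.det_apply]
  generalize f 0 = i, f 1 = j
  fin_cases i <;> fin_cases j <;>
    simp [Matrix.det_fin_three, Module.Basis.toMatrix_apply, map_pair_self,
      map_pair_swap β (b 1) (b 0), map_pair_swap β (b 2) (b 0), map_pair_swap β (b 2) (b 1)]

theorem exists_isReebVector (h : wedge a β ≠ 0) : ∃ R, IsReebVector a β R := by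
  obtain ⟨v, rfl⟩ := exists_curryLeft_det_eq b β
  have hv : a v ≠ 0 := by
    rw [wedge_curryLeft b] at h
    exact left_ne_zero_of_smul h
  refine ⟨(a v)⁻¹ • v, ?_, ?_⟩
  · rw [map_smul, smul_eq_mul, inv_mul_cancel₀ hv]
  · rw [map_smul, AlternatingMap.curryLeft_same, smul_zero]

theorem eq_zero_of_apply_eq_zero_of_curryLeft_eq_zero (h : wedge a β ≠ 0) {v : V} (ha : a v = 0)
    (hβ : β.curryLeft v = 0) : v = 0 :=
  eq_zero_of_curryLeft_eq_zero b h (by rw [curryLeft_wedge hβ, ha, zero_smul])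

end AlternatingForms

section InnerProducts

variable {V : Type*} [AddCommGroup V] [Module ℝ V]

/-- Inner products on `V`, as bilinear forms: the values of a Riemannian metric. -/
structure IsInnerProduct (B : V →ₗ[ℝ] V →ₗ[ℝ] ℝ) : Prop where
  symm (v w : V) : B v w = B w v
  pos (v : V) : v ≠ 0 → 0 < B v v

/-- The volume form `√|g| b⁰ ∧ b¹ ∧ b²` of the bilinear form `B` for the orientation of the
basis `b`. -/
def volumeForm (b : Module.Basis (Fin 3) ℝ V) (B : V →ₗ[ℝ] V →ₗ[ℝ] ℝ) : V [⋀^Fin 3]→ₗ[ℝ] ℝ :=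
  √(gram b fun v w => B v w).det • b.det

/-- The unsigned ratio `|η / vol|` of a 3-form `η` to the volume forms of `B`; by
`volumeRatio_eq` it does not depend on the basis. -/
def volumeRatio (b : Module.Basis (Fin 3) ℝ V) (B : V →ₗ[ℝ] V →ₗ[ℝ] ℝ)
    (η : V [⋀^Fin 3]→ₗ[ℝ] ℝ) : ℝ :=
  |η b| / √(gram b fun v w => B v w).det

variable (b : Module.Basis (Fin 3) ℝ V) {B : V →ₗ[ℝ] V →ₗ[ℝ] ℝ} {a : V →ₗ[ℝ] ℝ}

theorem gram_eq_toMatrix (B : V →ₗ[ℝ] V →ₗ[ℝ] ℝ) :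
    (gram b fun v w => B v w) = LinearMap.BilinForm.toMatrix b B :=
  (Matrix.ext fun i j => LinearMap.BilinForm.toMatrix_apply b B i j).symm

theorem hodgeIn_eq (B : V →ₗ[ℝ] V →ₗ[ℝ] ℝ) (a : V →ₗ[ℝ] ℝ) :
    hodgeIn b (fun v w => B v w) a =
      (volumeForm b B).curryLeft (sharpIn b (fun v w => B v w) a) := by
  rw [hodgeIn, volumeForm, AlternatingMap.curryLeft_smul, LinearMap.smul_apply, sharpIn]
  simp only [map_sum, map_smul]

theorem gram_det_eq_sq_mul (b' : Module.Basis (Fin 3) ℝ V) (B : V →ₗ[ℝ] V →ₗ[ℝ] ℝ) :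
    (gram b' fun v w => B v w).det = b.det b' ^ 2 * (gram b fun v w => B v w).det := by
  rw [gram_eq_toMatrix, gram_eq_toMatrix, ← LinearMap.BilinForm.toMatrix_mul_basis_toMatrix b b',
    Matrix.det_mul, Matrix.det_mul, Matrix.det_transpose, b.det_apply]
  ring

theorem volumeRatio_eq (b' : Module.Basis (Fin 3) ℝ V) (B : V →ₗ[ℝ] V →ₗ[ℝ] ℝ)
    (η : V [⋀^Fin 3]→ₗ[ℝ] ℝ) : volumeRatio b' B η = volumeRatio b B η := by
  have hη : η b' = b.det b' * η b := by
    conv_lhs => rw [AlternatingMap.eq_smul_basis_det b η]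
    exact mul_comm _ _
  rw [volumeRatio, volumeRatio, hη, gram_det_eq_sq_mul b b', Real.sqrt_mul (sq_nonneg _),
    Real.sqrt_sq_eq_abs, abs_mul, mul_div_mul_left _ _ (abs_ne_zero.2 (b.isUnit_det b').ne_zero)]

namespace IsInnerProduct

variable (hB : IsInnerProduct B)

include hB

theorem gram_det_pos : 0 < (gram b fun v w => B v w).det := by
  rw [gram_eq_toMatrix]
  refine Matrix.PosDef.det_pos (.of_dotProduct_mulVec_pos ?_ fun x hx => ?_)
  · ext i j
    simpa only [Matrix.conjTranspose_apply, LinearMap.BilinForm.toMatrix_apply, star_trivial]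
      using hB.symm (b j) (b i)
  · rw [star_trivial, LinearMap.BilinForm.dotProduct_toMatrix_mulVec]
    exact hB.pos _ (b.equivFun.symm.map_ne_zero_iff.2 hx)

theorem volumeForm_ne_zero : volumeForm b B ≠ 0 :=
  smul_ne_zero (Real.sqrt_pos.2 (hB.gram_det_pos b)).ne' b.det_ne_zero

theorem volumeRatio_pos {η : V [⋀^Fin 3]→ₗ[ℝ] ℝ} (hη : η ≠ 0) : 0 < volumeRatio b B η :=
  div_pos (abs_pos.2 ((AlternatingMap.map_basis_ne_zero_iff b η).2 hη))
    (Real.sqrt_pos.2 (hB.gram_det_pos b))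

theorem volumeRatio_smul_volumeForm {η : V [⋀^Fin 3]→ₗ[ℝ] ℝ} (hη : 0 < η b) :
    volumeRatio b B η • volumeForm b B = η := by
  rw [volumeRatio, volumeForm, smul_smul,
    div_mul_cancel₀ _ (Real.sqrt_pos.2 (hB.gram_det_pos b)).ne', abs_of_pos hη]
  exact (AlternatingMap.eq_smul_basis_det b η).symm

theorem apply_sharpIn (a : V →ₗ[ℝ] ℝ) : B (sharpIn b (fun v w => B v w) a) = a := by
  refine b.ext fun k => ?_
  have hinv := Matrix.nonsing_inv_mul _ (hB.gram_det_pos b).ne'.isUnit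
  calc B (sharpIn b (fun v w => B v w) a) (b k)
      = ∑ i, a (b i) * ((gram b fun v w => B v w)⁻¹ * gram b fun v w => B v w) i k := by
        simp only [sharpIn, map_sum, map_smul, LinearMap.sum_apply, LinearMap.smul_apply,
          smul_eq_mul, Matrix.mul_apply, Finset.mul_sum, mul_assoc, gram, Matrix.of_apply]
    _ = a (b k) := by simp [hinv, Matrix.one_apply]

theorem sharpIn_eq {v : V} (h : B v = a) : sharpIn b (fun v w => B v w) a = v := by
  by_contra hne
  refine (hB.pos _ (sub_ne_zero.2 hne)).ne' ?_
  rw [map_sub B, hB.apply_sharpIn b, h, sub_self, LinearMap.zero_apply]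

theorem apply_sharpIn_pos (ha : a ≠ 0) : 0 < a (sharpIn b (fun v w => B v w) a) := by
  have h := hB.apply_sharpIn b a
  rw [← DFunLike.congr_fun h]
  refine hB.pos _ fun h₀ => ha ?_
  rw [← h, h₀, map_zero]

/- Both directions rest on `*a = ι_{a♯} vol`, where `a♯ = p⁻¹ R`. -/
theorem eq_smul_hodgeIn_iff {β : V [⋀^Fin 2]→ₗ[ℝ] ℝ} {R : V} {c p : ℝ} (hp : p ≠ 0)
    (haR : a R = 1) (hBR : B R = p • a) :
    β = c • hodgeIn b (fun v w => B v w) a ↔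
      β.curryLeft R = 0 ∧ p • wedge a β = c • volumeForm b B := by
  have hsharp : sharpIn b (fun v w => B v w) a = p⁻¹ • R :=
    hB.sharpIn_eq b (by rw [map_smul, hBR, inv_smul_smul₀ hp])
  rw [hodgeIn_eq, hsharp, map_smul]
  constructor
  · rintro rfl
    refine ⟨?_, ?_⟩
    · simp only [AlternatingMap.curryLeft_smul, LinearMap.smul_apply,
        AlternatingMap.curryLeft_same, smul_zero]
    · rw [wedge_smul, wedge_smul, wedge_curryLeft b, haR, one_smul, smul_comm c,
        smul_inv_smul₀ hp]
  · rintro ⟨hβ, h⟩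
    rw [smul_comm, ← LinearMap.smul_apply, ← AlternatingMap.curryLeft_smul, ← h,
      AlternatingMap.curryLeft_smul, LinearMap.smul_apply, inv_smul_smul₀ hp, curryLeft_wedge hβ,
      haR, one_smul]

theorem wedge_ne_zero_of_eq_smul_hodgeIn (ha : a ≠ 0) {c : ℝ} (hc : c ≠ 0)
    {β : V [⋀^Fin 2]→ₗ[ℝ] ℝ} (hβ : β = c • hodgeIn b (fun v w => B v w) a) : wedge a β ≠ 0 := by
  rw [hβ, hodgeIn_eq, wedge_smul, wedge_curryLeft b]
  exact smul_ne_zero hc (smul_ne_zero (hB.apply_sharpIn_pos b ha).ne' (hB.volumeForm_ne_zero b))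

end IsInnerProduct

/-- The inner product `B`, for which the linear form `a` has length one, stretched by the factor
`s` along the vector dual to `a` and by `√q` along the kernel of `a`. -/
def stretchForm (B : V →ₗ[ℝ] V →ₗ[ℝ] ℝ) (a : V →ₗ[ℝ] ℝ) (s q : ℝ) : V →ₗ[ℝ] V →ₗ[ℝ] ℝ :=
  s ^ 2 • a.smulRight a + q • (B - a.smulRight a)

theorem stretchForm_apply (B : V →ₗ[ℝ] V →ₗ[ℝ] ℝ) (a : V →ₗ[ℝ] ℝ) (s q : ℝ) (v w : V) :
    stretchForm B a s q v w = s ^ 2 * (a v * a w) + q * (B v w - a v * a w) := by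
  simp [stretchForm]

variable {R : V} (haR : a R = 1) (hBR : B R = a) {s q : ℝ}

include haR hBR

theorem stretchForm_apply_self : stretchForm B a s q R = s ^ 2 • a := by
  ext v
  simp [stretchForm_apply, haR, hBR]

theorem IsInnerProduct.stretchForm (hB : IsInnerProduct B) (hs : 0 < s) (hq : 0 < q) :
    IsInnerProduct (stretchForm B a s q) where
  symm v w := by rw [stretchForm_apply, stretchForm_apply, hB.symm v w, mul_comm (a v)]
  pos v hv := by
    have hplane : B (v - a v • R) (v - a v • R) = B v v - a v * a v := by
      simp [hBR, haR, hB.symm v R]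
    rw [stretchForm_apply, ← hplane]
    by_cases h : v - a v • R = 0
    · have hav : a v ≠ 0 := fun h₀ => hv (by rwa [h₀, zero_smul, sub_zero] at h)
      have := mul_self_pos.2 hav
      rw [h, map_zero]
      positivity
    · have := hB.pos _ h
      have := mul_self_nonneg (a v)
      positivity

/- `stretchForm B a s q v w = q * B v (T w)` for the transvection `T w = w + (s² / q - 1) a(w) R`,
whose determinant is `s² / q`. -/
theorem gram_stretchForm_det (hB : IsInnerProduct B) (hq : q ≠ 0) :
    (gram b fun v w => stretchForm B a s q v w).det =
      (s * q) ^ 2 * (gram b fun v w => B v w).det := by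
  have := Module.Finite.of_basis b
  have hT : stretchForm B a s q =
      q • LinearMap.BilinForm.compRight B (LinearMap.transvection a ((s ^ 2 / q - 1) • R)) := by
    ext v w
    simp [stretchForm_apply, LinearMap.transvection.apply, hB.symm v R, hBR]
    field_simp
    ring
  rw [gram_eq_toMatrix, gram_eq_toMatrix, hT, map_smul, LinearMap.BilinForm.toMatrix_compRight,
    Matrix.det_smul, Matrix.det_mul, LinearMap.det_toMatrix, LinearMap.transvection.det, map_smul,
    haR, Fintype.card_fin, smul_eq_mul, mul_one, add_sub_cancel]
  field_simp

theorem volumeForm_stretchForm (hB : IsInnerProduct B) (hs : 0 < s) (hq : 0 < q) :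
    volumeForm b (stretchForm B a s q) = (s * q) • volumeForm b B := by
  rw [volumeForm, gram_stretchForm_det b haR hBR hB hq.ne', Real.sqrt_mul (sq_nonneg _),
    Real.sqrt_sq (mul_pos hs hq).le, mul_smul, volumeForm]

theorem eq_smul_hodgeIn_stretchForm {β : V [⋀^Fin 2]→ₗ[ℝ] ℝ} {c : ℝ} (hB : IsInnerProduct B)
    (hβ : β.curryLeft R = 0) (hs : 0 < s) (hq : 0 < q)
    (h : s • wedge a β = (c * q) • volumeForm b B) :
    β = c • hodgeIn b (fun v w => stretchForm B a s q v w) a := by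
  refine ((hB.stretchForm haR hBR hs hq).eq_smul_hodgeIn_iff b (pow_pos hs 2).ne' haR
    (stretchForm_apply_self haR hBR)).2 ⟨hβ, ?_⟩
  rw [volumeForm_stretchForm b haR hBR hB hs hq, sq, mul_smul, h, smul_smul, smul_smul]
  ring_nf

end InnerProducts

section ReebForms

variable {V : Type*} [AddCommGroup V] [Module ℝ V] {a : V →ₗ[ℝ] ℝ} {β : V [⋀^Fin 2]→ₗ[ℝ] ℝ}
  {ι : Type*} [Fintype ι]

/-- The symmetric form `a ⊗ a + ∑ᵢ ι_{eᵢ}β ⊗ ι_{eᵢ}β` of a family of vectors `e`, an inner product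
for which the Reeb vector of `(a, β)` is dual to `a` as soon as `e` spans and `a ∧ β ≠ 0`. -/
def reebForm (e : ι → V) (a : V →ₗ[ℝ] ℝ) (β : V [⋀^Fin 2]→ₗ[ℝ] ℝ) : V →ₗ[ℝ] V →ₗ[ℝ] ℝ :=
  let θ (i : ι) := (AlternatingMap.ofSubsingleton ℝ V ℝ (0 : Fin 1)).symm (β.curryLeft (e i))
  a.smulRight a + ∑ i, (θ i).smulRight (θ i)

theorem reebForm_apply (e : ι → V) (a : V →ₗ[ℝ] ℝ) (β : V [⋀^Fin 2]→ₗ[ℝ] ℝ) (v w : V) :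
    reebForm e a β v w = a v * a w + ∑ i, β ![e i, v] * β ![e i, w] := by
  have hpair (i : ι) (u : V) : Matrix.vecCons (e i) (fun _ : Fin 1 => u) = ![e i, u] :=
    List.ofFn_injective rfl
  simp [reebForm, hpair]

theorem reebForm_apply_reeb (e : ι → V) {R : V} (hR : IsReebVector a β R) :
    reebForm e a β R = a := by
  have hβ (v : V) : β ![v, R] = 0 := by
    rw [map_pair_swap, ← AlternatingMap.curryLeft_apply_apply, hR.curryLeft_eq_zero,
      AlternatingMap.zero_apply, neg_zero]
  ext v
  simp [reebForm_apply, hβ, hR.apply_eq_one]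

theorem isInnerProduct_reebForm (b : Module.Basis (Fin 3) ℝ V) (h : wedge a β ≠ 0) :
    IsInnerProduct (reebForm b a β) where
  symm v w := by simp only [reebForm_apply, mul_comm]
  pos v hv := by
    have hsq (x : ℝ) : 0 ≤ x * x := mul_self_nonneg x
    have hsum := Finset.sum_nonneg fun i (_ : i ∈ Finset.univ) => hsq (β ![b i, v])
    rw [reebForm_apply]
    refine (add_nonneg (hsq _) hsum).lt_of_ne' fun h₀ => hv ?_
    obtain ⟨ha, hβ⟩ := (add_eq_zero_iff_of_nonneg (hsq _) hsum).1 h₀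
    rw [Finset.sum_eq_zero_iff_of_nonneg fun _ _ => hsq _] at hβ
    have hcontract : β.curryLeft v = 0 := by
      refine (AlternatingMap.ofSubsingleton ℝ V ℝ (0 : Fin 1)).symm.injective (b.ext fun i => ?_)
      have hpair : Matrix.vecCons v (fun _ : Fin 1 => b i) = ![v, b i] := List.ofFn_injective rfl
      simpa [hpair, map_pair_swap β v] using hβ i (Finset.mem_univ i)
    exact eq_zero_of_apply_eq_zero_of_curryLeft_eq_zero b h (mul_self_eq_zero.1 ha) hcontract

end ReebForms

section Frames

variable {E F H M : Type*} [NormedAddCommGroup E] [NormedSpace ℝ E] [NormedAddCommGroup F]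
  [NormedSpace ℝ F] [TopologicalSpace H] {I : ModelWithCorners ℝ E H} [TopologicalSpace M]
  [ChartedSpace H M] {x₀ x : M}

theorem contMDiffAt_clm_iff_apply {E' : Type*} [NormedAddCommGroup E'] [NormedSpace ℝ E']
    [FiniteDimensional ℝ E'] {n : ℕ∞ω} {L : M → E' →L[ℝ] F} :
    ContMDiffAt I 𝓘(ℝ, E' →L[ℝ] F) n L x ↔
      ∀ v, ContMDiffAt I 𝓘(ℝ, F) n (fun y => L y v) x := by
  refine ⟨fun hL v => hL.clm_apply contMDiffAt_const, fun hL => ?_⟩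
  let b := Module.finBasis ℝ E'
  have h (y : M) : L y = ∑ i, ContinuousLinearMap.smulRightL ℝ E' F
      (LinearMap.toContinuousLinearMap (b.coord i)) (L y (b i)) := by
    ext v
    conv_lhs => rw [← b.sum_repr v, map_sum]
    simp only [map_smul, sum_apply, ContinuousLinearMap.smulRightL_apply_apply,
      ContinuousLinearMap.smulRight_apply, LinearMap.coe_toContinuousLinearMap',
      Module.Basis.coord_apply]
  rw [funext h]
  exact ContMDiffAt.sum fun i _ =>
    (ContinuousLinearMap.smulRightL ℝ E' F _).contMDiff.contMDiffAt.comp x (hL _)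

variable [IsManifold I ∞ M]

variable (I) in
/-- The coordinate frame of the preferred chart at `x₀`, as a linear map from the model space to
the tangent space at `x`; it is meaningful for `x` in the domain of that chart. -/
def frame (x₀ x : M) : E →L[ℝ] TangentSpace I x :=
  (trivializationAt E (TangentSpace I) x₀).symmL ℝ x

variable (hx : x ∈ (chartAt H x₀).source)

include hx

theorem contMDiffAt_oneForm_iff [FiniteDimensional ℝ E] {α : ∀ y : M, TangentSpace I y →L[ℝ] ℝ} :
    ContMDiffAt I (I.prod 𝓘(ℝ, E →L[ℝ] ℝ)) ∞
        (fun y => TotalSpace.mk' (E →L[ℝ] ℝ) (E := fun y => TangentSpace I y →L[ℝ] ℝ) y (α y)) x ↔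
      ∀ v, ContMDiffAt I 𝓘(ℝ) ∞ (fun y => α y (frame I x₀ y v)) x := by
  rw [Trivialization.contMDiffAt_section_iff
    (trivializationAt (E →L[ℝ] ℝ) (fun y : M => TangentSpace I y →L[ℝ] ℝ) x₀) ⟨hx, trivial⟩]
  rw [contMDiffAt_clm_iff_apply]
  refine forall_congr' fun v => Filter.EventuallyEq.contMDiffAt_iff ?_
  refine Filter.Eventually.of_forall fun y => ?_
  simp [ContinuousLinearMap.inCoordinates, hom_trivializationAt_apply, frame,
    -Trivialization.symmL_apply]

set_option synthInstance.maxHeartbeats 200000 in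
-- instance search through the nested hom bundles is slow
theorem contMDiffAt_bilin_iff [FiniteDimensional ℝ E]
    {B : ∀ y : M, TangentSpace I y →L[ℝ] TangentSpace I y →L[ℝ] ℝ} :
    ContMDiffAt I (I.prod 𝓘(ℝ, E →L[ℝ] E →L[ℝ] ℝ)) ∞
        (fun y => TotalSpace.mk' (E →L[ℝ] E →L[ℝ] ℝ)
          (E := fun y => TangentSpace I y →L[ℝ] TangentSpace I y →L[ℝ] ℝ) y (B y)) x ↔
      ∀ v w, ContMDiffAt I 𝓘(ℝ) ∞ (fun y => B y (frame I x₀ y v) (frame I x₀ y w)) x := by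
  rw [Trivialization.contMDiffAt_section_iff (trivializationAt (E →L[ℝ] E →L[ℝ] ℝ)
    (fun y : M => TangentSpace I y →L[ℝ] TangentSpace I y →L[ℝ] ℝ) x₀) (by simpa using hx)]
  simp only [contMDiffAt_clm_iff_apply]
  refine forall₂_congr fun v w => Filter.EventuallyEq.contMDiffAt_iff ?_
  filter_upwards [(chartAt H x₀).open_source.mem_nhds hx] with y hy
  rw [hom_trivializationAt_apply, inCoordinates_apply_eq₂ hy hy (by trivial),
    ← Trivialization.symmL_apply (R := ℝ) _ hy, ← Trivialization.symmL_apply (R := ℝ) _ hy]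
  simp [frame, -Trivialization.symmL_apply]

end Frames

section ExteriorDerivative

variable {M : Type*} [TopologicalSpace M] [ChartedSpace E3 M] [IsManifold (𝓡 3) ∞ M]

instance (x : M) : FiniteDimensional ℝ (TangentSpace (𝓡 3) x) :=
  inferInstanceAs (FiniteDimensional ℝ E3)

instance (x : M) : T2Space (TangentSpace (𝓡 3) x) := inferInstanceAs (T2Space E3)

variable (α : OneForm M) {x₀ x : M}

omit [IsManifold (𝓡 3) ∞ M] in
theorem extChartAt_symm_mem_source (x₀ : M) {u : E3} (hu : u ∈ (extChartAt (𝓡 3) x₀).target) :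
    (extChartAt (𝓡 3) x₀).symm u ∈ (chartAt E3 x₀).source :=
  extChartAt_source (𝓡 3) x₀ ▸ (extChartAt (𝓡 3) x₀).map_target hu

omit [IsManifold (𝓡 3) ∞ M] in
theorem extChartAt_mem_target (hx : x ∈ (chartAt E3 x₀).source) :
    extChartAt (𝓡 3) x₀ x ∈ (extChartAt (𝓡 3) x₀).target :=
  (extChartAt (𝓡 3) x₀).map_source ((extChartAt_source (𝓡 3) x₀).symm ▸ hx)

theorem chartDeriv_eq (hx : x ∈ (chartAt E3 x₀).source) :
    chartDeriv x₀ x = (trivializationAt E3 (TangentSpace (𝓡 3)) x₀).continuousLinearMapAt ℝ x :=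
  (TangentBundle.continuousLinearMapAt_trivializationAt hx).symm

theorem chartDeriv_frame (hx : x ∈ (chartAt E3 x₀).source) (v : E3) :
    chartDeriv x₀ x (frame (𝓡 3) x₀ x v) = v := by
  rw [chartDeriv_eq hx]
  exact Trivialization.continuousLinearMapAt_symmL _ hx v

theorem frame_chartDeriv (hx : x ∈ (chartAt E3 x₀).source) (v : TangentSpace (𝓡 3) x) :
    frame (𝓡 3) x₀ x (chartDeriv x₀ x v) = v := by
  rw [chartDeriv_eq hx]
  exact Trivialization.symmL_continuousLinearMapAt _ hx v

theorem chartDeriv_comp_frame {x₁ : M} (h₁ : x ∈ (chartAt E3 x₁).source)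
    (h₀ : x ∈ (chartAt E3 x₀).source) (v : E3) :
    chartDeriv x₁ x (frame (𝓡 3) x₀ x v) =
      fderiv ℝ (extChartAt (𝓡 3) x₁ ∘ (extChartAt (𝓡 3) x₀).symm) (extChartAt (𝓡 3) x₀ x) v := by
  have hcomp := (tangentBundleCore (𝓡 3) M).coordChange_comp (achart E3 x₀) (achart E3 x)
    (achart E3 x₁) x ⟨⟨h₀, mem_chart_source E3 x⟩, h₁⟩ v
  rw [tangentBundleCore_coordChange_achart (I := 𝓡 3) x₀ x₁ x, ModelWithCorners.range_eq_univ,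
    fderivWithin_univ] at hcomp
  rw [chartDeriv_eq h₁, TangentBundle.continuousLinearMapAt_trivializationAt_eq_core h₁, frame,
    TangentBundle.symmL_trivializationAt_eq_core h₀]
  exact hcomp

theorem localForm_eq (x₀ : M) {u : E3} (hu : u ∈ (extChartAt (𝓡 3) x₀).target) :
    localForm α x₀ u = (α ((extChartAt (𝓡 3) x₀).symm u)).comp
      (frame (𝓡 3) x₀ ((extChartAt (𝓡 3) x₀).symm u)) := by
  rw [localForm, frame, chartSymmDeriv,
    TangentBundle.symmL_trivializationAt (I := 𝓡 3) (extChartAt_symm_mem_source x₀ hu),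
    ModelWithCorners.range_eq_univ, mfderivWithin_univ]
  congr 1
  rw! [(extChartAt (𝓡 3) x₀).right_inv hu]
  rfl

theorem contDiffAt_localForm (x₀ : M) {u : E3} (hu : u ∈ (extChartAt (𝓡 3) x₀).target) :
    ContDiffAt ℝ ∞ (localForm α x₀) u := by
  have htarget := (isOpen_extChartAt_target x₀).mem_nhds hu
  have hα : ContMDiffAt (𝓡 3) 𝓘(ℝ, E3 →L[ℝ] ℝ) ∞
      (fun y => (α y).comp (frame (𝓡 3) x₀ y)) ((extChartAt (𝓡 3) x₀).symm u) :=
    contMDiffAt_clm_iff_apply.2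
      ((contMDiffAt_oneForm_iff (extChartAt_symm_mem_source x₀ hu)).1 (α.contMDiff _))
  have hcomp := hα.comp u ((contMDiffOn_extChartAt_symm x₀).contMDiffAt htarget)
  refine (contMDiffAt_iff_contDiffAt.1 hcomp).congr_of_eventuallyEq ?_
  filter_upwards [htarget] with w hw using localForm_eq α x₀ hw

/-- The coordinate expression of a 1-form in the chart at `x₀`, as a differential form on `ℝ³` in
the sense of `extDeriv`. -/
def chartForm (x₀ : M) (u : E3) : E3 [⋀^Fin 1]→L[ℝ] ℝ :=
  ContinuousAlternatingMap.ofSubsingleton ℝ E3 ℝ (0 : Fin 1) (localForm α x₀ u)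

theorem contDiffAt_chartForm (x₀ : M) {u : E3} (hu : u ∈ (extChartAt (𝓡 3) x₀).target) :
    ContDiffAt ℝ ∞ (chartForm α x₀) u :=
  (ContinuousAlternatingMap.ofSubsingletonLIE (𝕜 := ℝ) (E := E3) (F := ℝ)
    (0 : Fin 1)).contDiff.contDiffAt.comp u (contDiffAt_localForm α x₀ hu)

theorem contDiffAt_extDeriv_chartForm (x₀ : M) {u : E3}
    (hu : u ∈ (extChartAt (𝓡 3) x₀).target) : ContDiffAt ℝ ∞ (extDeriv (chartForm α x₀)) u :=
  ContDiffAt.comp (g := ContinuousAlternatingMap.alternatizeUncurryFinCLM ℝ E3 ℝ (n := 1)) u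
    (ContinuousLinearMap.contDiff _).contDiffAt
    ((contDiffAt_chartForm α x₀ hu).fderiv_right (m := ∞) le_rfl)

theorem contDiffAt_extChartAt_comp_symm (hx : x ∈ (chartAt E3 x₀).source) :
    ContDiffAt ℝ ∞ (extChartAt (𝓡 3) x₀ ∘ (extChartAt (𝓡 3) x).symm) (extChartAt (𝓡 3) x x) := by
  have hsymm := (contMDiffOn_extChartAt_symm (I := 𝓡 3) (n := ∞) x).contMDiffAt
    ((isOpen_extChartAt_target x).mem_nhds (mem_extChartAt_target x))
  refine contMDiffAt_iff_contDiffAt.1 (ContMDiffAt.comp _ ?_ hsymm)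
  rw [extChartAt_to_inv]
  exact contMDiffAt_extChartAt' hx

theorem chartForm_eventuallyEq (hx : x ∈ (chartAt E3 x₀).source) :
    chartForm α x =ᶠ[𝓝 (extChartAt (𝓡 3) x x)] fun u =>
      (chartForm α x₀ ((extChartAt (𝓡 3) x₀ ∘ (extChartAt (𝓡 3) x).symm) u)).compContinuousLinearMap
        (fderiv ℝ (extChartAt (𝓡 3) x₀ ∘ (extChartAt (𝓡 3) x).symm) u) := by
  have hsource : (extChartAt (𝓡 3) x).symm ⁻¹' (chartAt E3 x₀).source ∈
      𝓝 (extChartAt (𝓡 3) x x) := by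
    refine continuousAt_extChartAt_symm x ?_
    rw [extChartAt_to_inv]
    exact (chartAt E3 x₀).open_source.mem_nhds hx
  filter_upwards [(isOpen_extChartAt_target x).mem_nhds (mem_extChartAt_target x), hsource]
    with u hu hu₀
  have hu₀' := (extChartAt_source (𝓡 3) x₀).symm ▸ hu₀
  ext v
  change localForm α x u (v 0) =
    localForm α x₀ (extChartAt (𝓡 3) x₀ ((extChartAt (𝓡 3) x).symm u)) (fderiv ℝ _ u (v 0))
  have htransition := chartDeriv_comp_frame hu₀ (extChartAt_symm_mem_source x hu) (v 0)
  rw [(extChartAt (𝓡 3) x).right_inv hu] at htransition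
  rw [localForm_eq α x hu, localForm_eq α x₀ ((extChartAt (𝓡 3) x₀).map_source hu₀'),
    (extChartAt (𝓡 3) x₀).left_inv hu₀', ← htransition, ContinuousLinearMap.comp_apply,
    ContinuousLinearMap.comp_apply, frame_chartDeriv hu₀]

theorem dForm_eq (hx : x ∈ (chartAt E3 x₀).source) :
    dForm α x = (extDeriv (chartForm α x₀) (extChartAt (𝓡 3) x₀ x)).toAlternatingMap.compLinearMap
      (chartDeriv x₀ x).toLinearMap := by
  have hself := mem_chart_source E3 x
  have hxx : (extChartAt (𝓡 3) x₀ ∘ (extChartAt (𝓡 3) x).symm) (extChartAt (𝓡 3) x x) =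
      extChartAt (𝓡 3) x₀ x := by rw [Function.comp_apply, extChartAt_to_inv]
  have hdiff : DifferentiableAt ℝ (chartForm α x₀) (extChartAt (𝓡 3) x₀ x) :=
    (contDiffAt_chartForm α x₀ (extChartAt_mem_target hx)).differentiableAt (by simp)
  have hpullback := extDeriv_pullback (hxx ▸ hdiff) (contDiffAt_extChartAt_comp_symm hx)
    (by rw [minSmoothness_of_isRCLikeNormedField]; exact ENat.LEInfty.out)
  rw [← (chartForm_eventuallyEq α hx).extDeriv_eq, hxx] at hpullback
  ext v
  change extDeriv (chartForm α x) _ (fun i => chartDeriv x x (v i)) = _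
  rw [hpullback]
  refine congrArg (extDeriv (chartForm α x₀) (extChartAt (𝓡 3) x₀ x)) (funext fun i => ?_)
  change fderiv ℝ _ _ (chartDeriv x x (v i)) = chartDeriv x₀ x (v i)
  rw [← chartDeriv_comp_frame hx hself, frame_chartDeriv hself]

theorem dForm_frame (hx : x ∈ (chartAt E3 x₀).source) (v : Fin 2 → E3) :
    dForm α x (fun i => frame (𝓡 3) x₀ x (v i)) =
      extDeriv (chartForm α x₀) (extChartAt (𝓡 3) x₀ x) v := by
  rw [dForm_eq α hx]
  exact congrArg _ (funext fun i => chartDeriv_frame hx (v i))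

theorem contMDiffAt_dForm_frame (hx : x ∈ (chartAt E3 x₀).source) (v w : E3) :
    ContMDiffAt (𝓡 3) 𝓘(ℝ) ∞
      (fun y => dForm α y ![frame (𝓡 3) x₀ y v, frame (𝓡 3) x₀ y w]) x := by
  have hd : ContMDiffAt (𝓡 3) 𝓘(ℝ, E3 [⋀^Fin 2]→L[ℝ] ℝ) ∞
      (fun y => extDeriv (chartForm α x₀) (extChartAt (𝓡 3) x₀ y)) x :=
    (contDiffAt_extDeriv_chartForm α x₀ (extChartAt_mem_target hx)).contMDiffAt.comp x
      (contMDiffAt_extChartAt' hx)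
  refine ((ContinuousAlternatingMap.apply ℝ E3 ℝ ![v, w]).contMDiff.contMDiffAt.comp x
    hd).congr_of_eventuallyEq ?_
  filter_upwards [(chartAt E3 x₀).open_source.mem_nhds hx] with y hy
  refine Eq.trans (congrArg _ ?_) (dForm_frame α hy ![v, w])
  exact List.ofFn_injective rfl

end ExteriorDerivative

section Orientations

variable {M : Type*} [TopologicalSpace M] [ChartedSpace E3 M] [IsManifold (𝓡 3) ∞ M]
  {α : OneForm M} {x₀ x : M}

/-- The coordinate frame of the preferred chart at `x₀`, as a basis of the tangent space at a
point `x` of the domain of that chart. -/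
def frameBasis (hx : x ∈ (chartAt E3 x₀).source) :
    Module.Basis (Fin 3) ℝ (TangentSpace (𝓡 3) x) :=
  (EuclideanSpace.basisFun (Fin 3) ℝ).toBasis.map
    { (frame (𝓡 3) x₀ x).toLinearMap with
      invFun := chartDeriv x₀ x
      left_inv := chartDeriv_frame hx
      right_inv := frame_chartDeriv hx }

theorem coe_frameBasis (hx : x ∈ (chartAt E3 x₀).source) :
    ⇑(frameBasis hx) = fun i => frame (𝓡 3) x₀ x (EuclideanSpace.basisFun (Fin 3) ℝ i) :=
  funext fun i => by rw [frameBasis, Module.Basis.map_apply, OrthonormalBasis.coe_toBasis]; rfl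

theorem contMDiffAt_wedgeD_frame (α : OneForm M) (hx : x ∈ (chartAt E3 x₀).source)
    (v : Fin 3 → E3) :
    ContMDiffAt (𝓡 3) 𝓘(ℝ) ∞ (fun y => wedgeD α y fun i => frame (𝓡 3) x₀ y (v i)) x := by
  have ha (i : Fin 3) := (contMDiffAt_oneForm_iff hx).1 (α.contMDiff x) (v i)
  have hβ (i j : Fin 3) := contMDiffAt_dForm_frame α hx (v i) (v j)
  have hv (y : M) : (fun i => frame (𝓡 3) x₀ y (v i)) =
      ![frame (𝓡 3) x₀ y (v 0), frame (𝓡 3) x₀ y (v 1), frame (𝓡 3) x₀ y (v 2)] :=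
    List.ofFn_injective rfl
  simp only [hv, wedgeD, wedge_apply]
  exact (((ha 0).mul (hβ 1 2)).sub ((ha 1).mul (hβ 0 2))).add ((ha 2).mul (hβ 0 1))

theorem eventually_wedgeD_apply_mul_pos (hα : IsContactForm α) (x₀ : M) :
    ∀ᶠ y in 𝓝 x₀, ∃ hy : y ∈ (chartAt E3 x₀).source,
      0 < wedgeD α y (frameBasis hy) *
        wedgeD α x₀ (frameBasis (mem_chart_source E3 x₀)) := by
  have h₀ := mem_chart_source E3 x₀
  have hne := (AlternatingMap.map_basis_ne_zero_iff (frameBasis h₀) _).2 (hα x₀)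
  have hcont := (contMDiffAt_wedgeD_frame α h₀
    (EuclideanSpace.basisFun (Fin 3) ℝ)).continuousAt.mul_const (wedgeD α x₀ (frameBasis h₀))
  have hpos := hcont.eventually (lt_mem_nhds (a := 0)
    (by simpa only [← coe_frameBasis h₀] using mul_self_pos.2 hne))
  filter_upwards [hpos, (chartAt E3 x₀).open_source.mem_nhds h₀] with y hpos hy
  exact ⟨hy, by rwa [coe_frameBasis hy]⟩

/-- The orientation for which `α ∧ dα` is positive; near `x₀` it is given by the value of
`α ∧ dα` at `x₀`, read in the chart. -/
def inducedOrientation (hα : IsContactForm α) : ManifoldOrientation M where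
  at' x := rayOfNeZero ℝ _ (hα x)
  coherent x₀ := by
    have h₀ := mem_chart_source E3 x₀
    refine ⟨(wedgeD α x₀).compLinearMap (frame (𝓡 3) x₀ x₀).toLinearMap, ?_⟩
    filter_upwards [eventually_wedgeD_apply_mul_pos hα x₀] with y ⟨hy, hpos⟩
    set θ := ((wedgeD α x₀).compLinearMap (frame (𝓡 3) x₀ x₀).toLinearMap).compLinearMap
      (chartDeriv x₀ y).toLinearMap
    have hθ : wedgeD α x₀ (frameBasis h₀) = θ (frameBasis hy) := by
      rw [coe_frameBasis, coe_frameBasis]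
      exact congrArg _ (funext fun i => (congrArg _ (chartDeriv_frame hy _)).symm)
    rw [hθ] at hpos
    have hθ₀ : θ ≠ 0 := (AlternatingMap.map_basis_ne_zero_iff (frameBasis hy) θ).1
      (right_ne_zero_of_mul hpos.ne')
    exact ⟨hθ₀, (ray_eq_iff _ _).2 (sameRay_of_apply_mul_apply_pos (frameBasis hy) hpos)⟩

theorem isInducedOrientation_inducedOrientation (hα : IsContactForm α) :
    IsInducedOrientation (inducedOrientation hα) α :=
  fun x => ⟨hα x, rfl⟩

/-- The basis of `T_x M` in which `hodge` is computed: the coordinate basis with one vector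
negated if needed. -/
def orientedBasis (o : ManifoldOrientation M) (x : M) :
    Module.Basis (Fin 3) ℝ (TangentSpace (𝓡 3) x) :=
  (coordBasis x).adjustToOrientation (o.at' x)

theorem wedgeD_orientedBasis_pos {o : ManifoldOrientation M} (ho : IsInducedOrientation o α)
    (x : M) : 0 < wedgeD α x (orientedBasis o x) := by
  obtain ⟨h, hx⟩ := ho x
  refine apply_pos_of_orientation_eq _ h ?_
  rw [orientedBasis, Module.Basis.orientation_adjustToOrientation, hx]

end Orientations

section Metrics

theorem isCoercive_of_pos {E : Type*} [NormedAddCommGroup E] [NormedSpace ℝ E]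
    [FiniteDimensional ℝ E] {B : E →L[ℝ] E →L[ℝ] ℝ} (hB : ∀ v, v ≠ 0 → 0 < B v v) :
    IsCoercive B := by
  rcases subsingleton_or_nontrivial E with hE | hE
  · exact ⟨1, one_pos, fun v => by simp [Subsingleton.elim v 0]⟩
  have hcont : Continuous fun v => B v v := by fun_prop
  obtain ⟨u, hu, hmin⟩ := (isCompact_sphere (0 : E) 1).exists_isMinOn
    (NormedSpace.sphere_nonempty.2 zero_le_one) hcont.continuousOn
  refine ⟨B u u, hB u (ne_zero_of_mem_unit_sphere ⟨u, hu⟩), fun v => ?_⟩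
  rcases eq_or_ne v 0 with rfl | hv
  · simp
  have hunit : ‖v‖⁻¹ • v ∈ Metric.sphere (0 : E) 1 := by
    rw [mem_sphere_zero_iff_norm]
    exact norm_smul_inv_norm hv
  calc B u u * ‖v‖ * ‖v‖ ≤ B (‖v‖⁻¹ • v) (‖v‖⁻¹ • v) * ‖v‖ * ‖v‖ := by
        gcongr
        exact hmin hunit
    _ = B v v := by
        have := norm_ne_zero_iff.2 hv
        simp only [map_smul, smul_apply, smul_eq_mul]
        field_simp

theorem isVonNBounded_of_isCoercive {E : Type*} [NormedAddCommGroup E] [NormedSpace ℝ E]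
    {B : E →L[ℝ] E →L[ℝ] ℝ} (hB : IsCoercive B) :
    Bornology.IsVonNBounded ℝ {v : E | B v v < 1} := by
  obtain ⟨c, hc, hcB⟩ := hB
  rw [NormedSpace.isVonNBounded_iff, isBounded_iff_forall_norm_le]
  refine ⟨√c⁻¹, fun v (hv : B v v < 1) => Real.le_sqrt_of_sq_le ?_⟩
  rw [inv_eq_one_div, le_div_iff₀' hc, sq, ← mul_assoc]
  exact (hcB v).trans hv.le

variable {M : Type*} [TopologicalSpace M] [ChartedSpace E3 M] [IsManifold (𝓡 3) ∞ M]
  {α : OneForm M} {g : Metric3 M} {x₀ x : M}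

/-- The value of the metric `g` at `x`, as a bilinear form. -/
def metricForm (g : Metric3 M) (x : M) :
    TangentSpace (𝓡 3) x →ₗ[ℝ] TangentSpace (𝓡 3) x →ₗ[ℝ] ℝ :=
  (g.inner x).toLinearMap₁₂

theorem isInnerProduct_metricForm (g : Metric3 M) (x : M) : IsInnerProduct (metricForm g x) :=
  ⟨g.symm x, g.pos x⟩

theorem metricForm_sharp (g : Metric3 M) (α : OneForm M) (x : M) :
    metricForm g x (sharp g α x) = (α x).toLinearMap :=
  (isInnerProduct_metricForm g x).apply_sharpIn (coordBasis x) _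

theorem contMDiffAt_metricForm_frame (g : Metric3 M) (hx : x ∈ (chartAt E3 x₀).source)
    (v w : E3) :
    ContMDiffAt (𝓡 3) 𝓘(ℝ) ∞
      (fun y => metricForm g y (frame (𝓡 3) x₀ y v) (frame (𝓡 3) x₀ y w)) x :=
  (contMDiffAt_bilin_iff hx).1 (g.contMDiff x) v w

theorem exists_metricForm_eq
    {B : ∀ x : M, TangentSpace (𝓡 3) x →ₗ[ℝ] TangentSpace (𝓡 3) x →ₗ[ℝ] ℝ}
    (hB : ∀ x, IsInnerProduct (B x))
    (hsmooth : ∀ x v w, ContMDiffAt (𝓡 3) 𝓘(ℝ) ∞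
      (fun y => B y (frame (𝓡 3) x y v) (frame (𝓡 3) x y w)) x) :
    ∃ g : Metric3 M, ∀ x, metricForm g x = B x :=
  ⟨{ inner := fun x => (B x).toContinuousBilinearMap
     symm := fun x => (hB x).symm
     pos := fun x => (hB x).pos
     isVonNBounded := fun x => isVonNBounded_of_isCoercive
       (isCoercive_of_pos (E := E3) (B := (B x).toContinuousBilinearMap) (hB x).pos)
     contMDiff := fun x => (contMDiffAt_bilin_iff (mem_chart_source E3 x)).2 (hsmooth x) },
    fun _ => rfl⟩

theorem contMDiff_volumeRatio (hα : IsContactForm α) (g : Metric3 M) :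
    ContMDiff (𝓡 3) 𝓘(ℝ) ∞
      fun x => volumeRatio (coordBasis x) (metricForm g x) (wedgeD α x) := by
  intro x₀
  have h₀ := mem_chart_source E3 x₀
  let e (x : M) (i : Fin 3) := frame (𝓡 3) x₀ x (EuclideanSpace.basisFun (Fin 3) ℝ i)
  let G (x : M) : Matrix (Fin 3) (Fin 3) ℝ := Matrix.of fun i j => metricForm g x (e x i) (e x j)
  have he {x : M} (hx : x ∈ (chartAt E3 x₀).source) : ⇑(frameBasis hx) = e x := coe_frameBasis hx
  have hgram {x : M} (hx : x ∈ (chartAt E3 x₀).source) :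
      (gram (frameBasis hx) fun v w => metricForm g x v w) = G x := by
    rw [gram, he]
  have hG : ContMDiffAt (𝓡 3) 𝓘(ℝ) ∞ (fun x => (G x).det) x₀ := by
    simp only [Matrix.det_apply']
    exact ContMDiffAt.sum fun σ _ => contMDiffAt_const.mul
      (ContMDiffAt.prod fun i _ => contMDiffAt_metricForm_frame g h₀ _ _)
  have hG₀ : 0 < (G x₀).det := by
    rw [← hgram h₀]
    exact (isInnerProduct_metricForm g x₀).gram_det_pos _
  have hW₀ : wedgeD α x₀ (e x₀) ≠ 0 := by
    rw [← he h₀]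
    exact (AlternatingMap.map_basis_ne_zero_iff _ _).2 (hα x₀)
  have hratio : ContMDiffAt (𝓡 3) 𝓘(ℝ) ∞ (fun x => |wedgeD α x (e x)| / √(G x).det) x₀ :=
    ((contDiffAt_abs hW₀).contMDiffAt.comp x₀ (contMDiffAt_wedgeD_frame α h₀ _)).div₀
      ((Real.contDiffAt_sqrt hG₀.ne').contMDiffAt.comp x₀ hG) (Real.sqrt_pos.2 hG₀).ne'
  refine hratio.congr_of_eventuallyEq ?_
  filter_upwards [(chartAt E3 x₀).open_source.mem_nhds h₀] with x hx
  rw [volumeRatio_eq (frameBasis hx), volumeRatio, hgram hx, he hx]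

end Metrics

section ReebMetrics

variable {M : Type*} [TopologicalSpace M] [ChartedSpace E3 M] [IsManifold (𝓡 3) ∞ M]
  {α : OneForm M} {o : ManifoldOrientation M} {g g' : Metric3 M} {x : M}

/-- The vector field metrically dual to `α` is the Reeb vector field of `α`: it spans the kernel
of `dα` and `α` has length one. -/
def IsReebMetric (g : Metric3 M) (α : OneForm M) : Prop :=
  ∀ x, IsReebVector (α x).toLinearMap (dForm α x) (sharp g α x)

/-- The inner products on `T_x M` for which the Reeb vector of `α` is dual to `α`, as a subset of
the continuous bilinear forms so that partitions of unity apply. -/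
def reebInnerProducts (α : OneForm M) (x : M) :
    Set (TangentSpace (𝓡 3) x →L[ℝ] TangentSpace (𝓡 3) x →L[ℝ] ℝ) :=
  {B | IsInnerProduct B.toLinearMap₁₂ ∧
    ∀ R, IsReebVector (α x).toLinearMap (dForm α x) R → B R = α x}

theorem convex_reebInnerProducts (α : OneForm M) (x : M) : Convex ℝ (reebInnerProducts α x) := by
  rintro B ⟨hB, hBR⟩ C ⟨hC, hCR⟩ s t hs ht hst
  refine ⟨⟨fun v w => ?_, fun v hv => ?_⟩, fun R hR => ?_⟩
  · exact congrArg₂ (s * · + t * ·) (hB.symm v w) (hC.symm v w)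
  · change 0 < s * B v v + t * C v v
    have hBv : 0 < B v v := hB.pos v hv
    have hCv : 0 < C v v := hC.pos v hv
    rcases hs.eq_or_lt with rfl | hs
    · rw [zero_mul, zero_add, (zero_add t).symm.trans hst, one_mul]
      exact hCv
    · positivity
  · rw [add_apply, smul_apply, smul_apply, hBR R hR, hCR R hR, ← add_smul, hst, one_smul]

theorem reebForm_mem_reebInnerProducts (hα : IsContactForm α) {x₀ : M}
    (hx : x ∈ (chartAt E3 x₀).source) :
    (reebForm (fun i => frame (𝓡 3) x₀ x (EuclideanSpace.basisFun (Fin 3) ℝ i))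
      (α x).toLinearMap (dForm α x)).toContinuousBilinearMap ∈ reebInnerProducts α x := by
  rw [← coe_frameBasis hx]
  exact ⟨isInnerProduct_reebForm (frameBasis hx) (hα x),
    fun R hR => ContinuousLinearMap.coe_injective (reebForm_apply_reeb (frameBasis hx) hR)⟩

theorem contMDiffAt_reebForm (α : OneForm M) {x₀ : M} (hx : x ∈ (chartAt E3 x₀).source) :
    ContMDiffAt (𝓡 3) ((𝓡 3).prod 𝓘(ℝ, E3 →L[ℝ] E3 →L[ℝ] ℝ)) ∞
      (fun y => TotalSpace.mk' (E3 →L[ℝ] E3 →L[ℝ] ℝ)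
        (E := fun y => TangentSpace (𝓡 3) y →L[ℝ] TangentSpace (𝓡 3) y →L[ℝ] ℝ) y
        (reebForm (fun i => frame (𝓡 3) x₀ y (EuclideanSpace.basisFun (Fin 3) ℝ i))
          (α y).toLinearMap (dForm α y)).toContinuousBilinearMap) x := by
  refine (contMDiffAt_bilin_iff hx).2 fun v w => ?_
  have ha := (contMDiffAt_oneForm_iff hx).1 (α.contMDiff x)
  have hβ := contMDiffAt_dForm_frame α hx
  simp only [LinearMap.toContinuousBilinearMap_apply, reebForm_apply]
  exact ((ha v).mul (ha w)).add (ContMDiffAt.sum fun i _ => (hβ _ v).mul (hβ _ w))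

set_option synthInstance.maxHeartbeats 200000 in
-- instance search through the nested hom bundles is slow
theorem exists_isReebMetric [T2Space M] [SecondCountableTopology M] (hα : IsContactForm α) :
    ∃ g : Metric3 M, IsReebMetric g α := by
  have : LocallyCompactSpace M := ChartedSpace.locallyCompactSpace E3 M
  have hpatch := exists_contMDiffSection_forall_mem_convex_of_local (𝓡 3) (n := ⊤)
    (F_fiber := E3 →L[ℝ] E3 →L[ℝ] ℝ)
    (fun x : M => TangentSpace (𝓡 3) x →L[ℝ] TangentSpace (𝓡 3) x →L[ℝ] ℝ)
    (reebInnerProducts α)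
  obtain ⟨B, hB⟩ := hpatch (convex_reebInnerProducts α) fun x₀ =>
    ⟨(chartAt E3 x₀).source, (chartAt E3 x₀).open_source.mem_nhds (mem_chart_source E3 x₀), _,
      fun x hx => (contMDiffAt_reebForm α hx).contMDiffWithinAt,
      fun x hx => reebForm_mem_reebInnerProducts hα hx⟩
  obtain ⟨g, hg⟩ := exists_metricForm_eq (fun x => (hB x).1) fun x v w =>
    (contMDiffAt_bilin_iff (mem_chart_source E3 x)).1 (B.contMDiff x) v w
  refine ⟨g, fun x => ?_⟩
  obtain ⟨R, hR⟩ := exists_isReebVector (coordBasis x) (hα x)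
  have hsharp : sharp g α x = R := (isInnerProduct_metricForm g x).sharpIn_eq (coordBasis x) <| by
    rw [hg x]
    exact congrArg ContinuousLinearMap.toLinearMap ((hB x).2 R hR)
  rwa [hsharp]

theorem IsReebMetric.exists_metricForm_eq_stretchForm (hg : IsReebMetric g α) {s q : M → ℝ}
    (hs : ContMDiff (𝓡 3) 𝓘(ℝ) ∞ s) (hq : ContMDiff (𝓡 3) 𝓘(ℝ) ∞ q) (hs₀ : ∀ x, 0 < s x)
    (hq₀ : ∀ x, 0 < q x) : ∃ g' : Metric3 M, ∀ x,
      metricForm g' x = stretchForm (metricForm g x) (α x).toLinearMap (s x) (q x) := by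
  refine exists_metricForm_eq (fun x => (isInnerProduct_metricForm g x).stretchForm
    (hg x).apply_eq_one (metricForm_sharp g α x) (hs₀ x) (hq₀ x)) fun x v w => ?_
  have hx := mem_chart_source E3 x
  have ha := (contMDiffAt_oneForm_iff hx).1 (α.contMDiff x)
  simp only [stretchForm_apply]
  exact (((hs x).pow 2).mul ((ha v).mul (ha w))).add
    ((hq x).mul ((contMDiffAt_metricForm_frame g hx v w).sub ((ha v).mul (ha w))))

theorem IsReebMetric.dForm_eq_smul_hodge (hg : IsReebMetric g α) {s q c : ℝ} (hs : 0 < s)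
    (hq : 0 < q) (hg' : metricForm g' x = stretchForm (metricForm g x) (α x).toLinearMap s q)
    (h : s • wedgeD α x = (c * q) • volumeForm (orientedBasis o x) (metricForm g x)) :
    dForm α x = c • hodge o g' α x := by
  have hβ := eq_smul_hodgeIn_stretchForm (orientedBasis o x) (hg x).apply_eq_one
    (metricForm_sharp g α x) (isInnerProduct_metricForm g x) (hg x).curryLeft_eq_zero hs hq h
  rwa [← hg'] at hβ

theorem exists_isAdapted [T2Space M] [SecondCountableTopology M] (hα : IsContactForm α)
    (ho : IsInducedOrientation o α) : ∃ g : Metric3 M, IsAdapted o g α := by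
  obtain ⟨g, hg⟩ := exists_isReebMetric hα
  let ρ (x : M) := volumeRatio (coordBasis x) (metricForm g x) (wedgeD α x)
  have hρ (x : M) : 0 < ρ x := (isInnerProduct_metricForm g x).volumeRatio_pos _ (hα x)
  obtain ⟨g', hg'⟩ := hg.exists_metricForm_eq_stretchForm (s := fun _ => 1) (q := fun x => ρ x / 2)
    contMDiff_const ((contMDiff_volumeRatio hα g).div_const 2) (fun _ => one_pos)
    fun x => half_pos (hρ x)
  refine ⟨g', hα, fun x => ⟨hg.dForm_eq_smul_hodge one_pos (half_pos (hρ x)) (hg' x) ?_, ?_⟩⟩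
  · have hvol := (isInnerProduct_metricForm g x).volumeRatio_smul_volumeForm _
      (wedgeD_orientedBasis_pos ho x)
    rw [volumeRatio_eq (coordBasis x)] at hvol
    rw [one_smul, mul_div_cancel₀ _ two_ne_zero]
    exact hvol.symm
  · have hdual : metricForm g' x (sharp g α x) = (α x).toLinearMap := by
      rw [hg' x, stretchForm_apply_self (hg x).apply_eq_one (metricForm_sharp g α x), one_pow,
        one_smul]
    have hsharp : sharp g' α x = sharp g α x :=
      (isInnerProduct_metricForm g' x).sharpIn_eq (coordBasis x) hdual
    rw [hsharp]
    exact (DFunLike.congr_fun hdual _).trans (hg x).apply_eq_one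

namespace IsAdapted

variable (hg : IsAdapted o g α)

include hg

theorem apply_sharp (x : M) : α x (sharp g α x) = 1 :=
  (DFunLike.congr_fun (metricForm_sharp g α x) _).symm.trans (hg.2 x).2

theorem curryLeft_eq_zero_and_wedgeD_eq (x : M) : (dForm α x).curryLeft (sharp g α x) = 0 ∧
    wedgeD α x = (2 : ℝ) • volumeForm (orientedBasis o x) (metricForm g x) := by
  have h := ((isInnerProduct_metricForm g x).eq_smul_hodgeIn_iff (orientedBasis o x) one_ne_zero
    (hg.apply_sharp x) ((metricForm_sharp g α x).trans (one_smul ℝ _).symm)).1 (hg.2 x).1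
  rwa [one_smul] at h

theorem isReebMetric : IsReebMetric g α :=
  fun x => ⟨hg.apply_sharp x, (hg.curryLeft_eq_zero_and_wedgeD_eq x).1⟩

/- Stretching by the factor `s` along the Reeb field and by `√q` along the contact planes
multiplies the volume form by `s q`, so `dα = f * α` amounts to `f q = 2 s`. -/
theorem exists_beltramiEq {f : C^∞⟮𝓡 3, M; ℝ⟯} (hf : ∀ x, 0 < f x) {c : ℝ} (hc : 0 < c) :
    ∃ g' : Metric3 M, BeltramiEq o g' f α ∧ ∀ x v w, g'.inner x v w =
      (c / f x) ^ 2 * (α x v * α x w) +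
        2 * c / f x ^ 2 * (g.inner x v w - α x v * α x w) := by
  have hs₀ (x : M) : 0 < c / f x := div_pos hc (hf x)
  have hq₀ (x : M) : 0 < 2 * c / f x ^ 2 := div_pos (mul_pos two_pos hc) (pow_pos (hf x) 2)
  obtain ⟨g', hg'⟩ := hg.isReebMetric.exists_metricForm_eq_stretchForm
    (contMDiff_const.div₀ f.contMDiff fun x => (hf x).ne')
    (contMDiff_const.div₀ (f.contMDiff.pow 2) fun x => (pow_pos (hf x) 2).ne') hs₀ hq₀
  refine ⟨g', fun x => hg.isReebMetric.dForm_eq_smul_hodge (hs₀ x) (hq₀ x) (hg' x) ?_,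
    fun x v w => ?_⟩
  · have := (hf x).ne'
    rw [(hg.curryLeft_eq_zero_and_wedgeD_eq x).2, smul_smul]
    congr 1
    field_simp
  · change metricForm g' x v w = _
    rw [hg' x, stretchForm_apply]
    rfl

theorem exists_isRescaling {f : C^∞⟮𝓡 3, M; ℝ⟯} (hf : ∀ x, 0 < f x) :
    ∃ g' : Metric3 M, IsRescaling (fun x => 4 / f x ^ 2) g g' ∧ BeltramiEq o g' f α := by
  obtain ⟨g', hBeltrami, hinner⟩ := hg.exists_beltramiEq hf two_pos
  refine ⟨g', fun x v w => ?_, hBeltrami⟩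
  rw [hinner]
  ring

theorem exists_ne_beltramiEq [Nonempty M] {f : C^∞⟮𝓡 3, M; ℝ⟯} (hf : ∀ x, 0 < f x) :
    ∃ g₁ g₂ : Metric3 M, g₁ ≠ g₂ ∧ BeltramiEq o g₁ f α ∧ BeltramiEq o g₂ f α := by
  obtain ⟨g₁, hBeltrami₁, hinner₁⟩ := hg.exists_beltramiEq hf one_pos
  obtain ⟨g₂, hBeltrami₂, hinner₂⟩ := hg.exists_beltramiEq hf two_pos
  refine ⟨g₁, g₂, fun heq => ?_, hBeltrami₁, hBeltrami₂⟩
  obtain ⟨x⟩ := ‹Nonempty M›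
  have h := (hinner₁ x _ _).symm.trans (heq ▸ hinner₂ x (sharp g α x) (sharp g α x))
  rw [hg.apply_sharp, (hg.2 x).2] at h
  have := (hf x).ne'
  field_simp at h
  norm_num at h

end IsAdapted

theorem IsRotationalBeltrami.isContactForm (h : IsRotationalBeltrami o g α)
    (hα : ∀ x, α x ≠ 0) : IsContactForm α := by
  obtain ⟨f, hf, hBeltrami⟩ := h
  exact fun x => (isInnerProduct_metricForm g x).wedge_ne_zero_of_eq_smul_hodgeIn
    (orientedBasis o x) (fun h₀ => hα x (ContinuousLinearMap.coe_injective h₀)) (hf x)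
    (hBeltrami x)

end ReebMetrics

end BeltramiContact

end

theorem proposition2 {M : Type*} [TopologicalSpace M] [T2Space M] [SecondCountableTopology M]
    [ChartedSpace E3 M] [IsManifold (𝓡 3) ∞ M] (α : OneForm M) :
    (∀ (o : ManifoldOrientation M) (g : Metric3 M),
      IsRotationalBeltrami o g α → (∀ x, α x ≠ 0) → IsContactForm α) ∧
    (IsContactForm α →
      ∃ o : ManifoldOrientation M, IsInducedOrientation o α ∧
        (∃ g : Metric3 M, IsAdapted o g α) ∧
        ∀ f : C^∞⟮𝓡 3, M; ℝ⟯, (∀ x, 0 < f x) →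
          (∀ g : Metric3 M, IsAdapted o g α → ∃ g' : Metric3 M,
            IsRescaling (fun x => 4 / f x ^ 2) g g' ∧
            BeltramiEq o g' f α ∧ IsRotationalBeltrami o g' α) ∧
          (Nonempty M → ∃ g₁ g₂ : Metric3 M, g₁ ≠ g₂ ∧
            BeltramiEq o g₁ f α ∧ BeltramiEq o g₂ f α)) := by
  refine ⟨fun o g h h₀ => h.isContactForm h₀, fun hα => ?_⟩
  have ho := isInducedOrientation_inducedOrientation hα
  obtain ⟨g, hg⟩ := exists_isAdapted hα ho
  refine ⟨inducedOrientation hα, ho, ⟨g, hg⟩, fun f hf => ⟨fun g hg => ?_, fun _ => ?_⟩⟩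
  · obtain ⟨g', hrescaling, hBeltrami⟩ := hg.exists_isRescaling hf
    exact ⟨g', hrescaling, hBeltrami, f, fun x => (hf x).ne', hBeltrami⟩
  · exact hg.exists_ne_beltramiEq hf
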